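/- Let $F$ be a finite field of order $2^n$ and let $\Theta$ be a nontrivial automorphism of $F$ of odd order. Let $M = A(n,\Theta)$ be the Suzuki $2$-group of type A, that is, the group with underlying set $F \times F$ and multiplication $$(a,c)\cdot(b,d) = (a+b,\; c+d+b\,\Theta(a)).$$ Consider the following subgroups of $\mathrm{Aut}(M)$: - $A_1$, the set of all maps $(a,b) \mapsto (a, \psi(a)+b)$, where $\psi$ runs over the $\mathbb{Z}/2$-linear maps $F \to F$; - $A_2$, the set of all maps $(a,b) \mapsto (xa, x\Theta(x)b)$, where $x$ runs over the nonzero elements of $F$; - $A_3$, the set of all maps $(a,b) \mapsto (\tau(a),\tau(b))$, where $\tau$ runs over the automorphisms of the field $F$. Then $\mathrm{Aut}(M) = A_1A_2A_3$, i.e. every automorphism of $M$ is a product $\alpha_1\alpha_2\alpha_3$ with $\alpha_i \in A_i$. -/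

import Mathlib

open scoped Pointwise

/-- The underlying set `F × F` of the group `A(n, Θ)`, where `F` is a field of order `2 ^ n`
and `Θ` is an automorphism of `F`. -/
@[ext]
structure SuzukiA {F : Type*} [Field F] [Algebra (ZMod 2) F] (Θ : F ≃ₐ[ZMod 2] F) where
  fst : F
  snd : F

namespace SuzukiA

section

variable {F : Type*} [Field F] [Algebra (ZMod 2) F] {Θ : F ≃ₐ[ZMod 2] F}

/-- The multiplication `(a, c) (b, d) = (a + b, c + d + b Θ(a))`. -/
instance : Mul (SuzukiA Θ) :=
  ⟨fun x y => ⟨x.fst + y.fst, x.snd + y.snd + y.fst * Θ x.fst⟩⟩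

instance : One (SuzukiA Θ) := ⟨⟨0, 0⟩⟩

instance : Inv (SuzukiA Θ) := ⟨fun x => ⟨-x.fst, x.fst * Θ x.fst - x.snd⟩⟩

theorem mk_mul_mk (a c b d : F) :
    (⟨a, c⟩ * ⟨b, d⟩ : SuzukiA Θ) = ⟨a + b, c + d + b * Θ a⟩ := rfl

@[simp] theorem mul_fst (x y : SuzukiA Θ) : (x * y).fst = x.fst + y.fst := rfl

@[simp] theorem mul_snd (x y : SuzukiA Θ) :
    (x * y).snd = x.snd + y.snd + y.fst * Θ x.fst := rfl

@[simp] theorem one_fst : (1 : SuzukiA Θ).fst = 0 := rfl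

@[simp] theorem one_snd : (1 : SuzukiA Θ).snd = 0 := rfl

@[simp] theorem inv_fst (x : SuzukiA Θ) : (x⁻¹).fst = -x.fst := rfl

@[simp] theorem inv_snd (x : SuzukiA Θ) : (x⁻¹).snd = x.fst * Θ x.fst - x.snd := rfl

instance : Group (SuzukiA Θ) :=
  Group.ofLeftAxioms
    (fun x y z => by
      ext
      · simp [add_assoc]
      · simp only [mul_snd, mul_fst, map_add]; ring)
    (fun x => by ext <;> simp)
    (fun x => by ext <;> simp)

variable (Θ)

/-- The homomorphism `ψ ↦ φ_ψ` where `φ_ψ (a, b) = (a, ψ(a) + b)`, for `ψ` running over the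
`ℤ/2`-linear maps `F → F`. -/
def phiLinear : Multiplicative (F →ₗ[ZMod 2] F) →* MulAut (SuzukiA Θ) where
  toFun ψ :=
    { toFun := fun x => ⟨x.fst, ψ.toAdd x.fst + x.snd⟩
      invFun := fun x => ⟨x.fst, -ψ.toAdd x.fst + x.snd⟩
      left_inv := fun x => by ext <;> simp
      right_inv := fun x => by ext <;> simp
      map_mul' := fun x y => by
        ext
        · simp
        · simp only [mul_snd, mul_fst, map_add]; ring }
  map_one' := by ext x <;> simp
  map_mul' ψ χ := by
    ext x
    · simp
    · simp [add_assoc]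

/-- The homomorphism `x ↦ φ_x` where `φ_x (a, b) = (x a, x Θ(x) b)`, for `x` running over the
nonzero elements of `F`. -/
def phiScalar : Fˣ →* MulAut (SuzukiA Θ) where
  toFun x :=
    { toFun := fun p => ⟨x * p.fst, x * Θ x * p.snd⟩
      invFun := fun p => ⟨(x : F)⁻¹ * p.fst, (x * Θ x : F)⁻¹ * p.snd⟩
      left_inv := fun p => by ext <;> simp [mul_assoc]
      right_inv := fun p => by ext <;> simp [mul_assoc, mul_left_comm]
      map_mul' := fun p q => by
        ext
        · simp [mul_add]
        · simp only [mul_snd, map_mul]; ring }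
  map_one' := by ext p <;> simp
  map_mul' x y := by
    ext p
    · simp [mul_assoc]
    · simp only [Units.val_mul, map_mul, MulAut.mul_apply, MulEquiv.coe_mk, Equiv.coe_fn_mk]; ring

theorem phiLinear_apply (ψ : F →ₗ[ZMod 2] F) (a b : F) :
    phiLinear Θ (Multiplicative.ofAdd ψ) ⟨a, b⟩ = ⟨a, ψ a + b⟩ := rfl

theorem phiScalar_apply (x : Fˣ) (a b : F) :
    phiScalar Θ x ⟨a, b⟩ = ⟨x * a, x * Θ x * b⟩ := rfl

/-- The subgroup `A₁` of all automorphisms `(a, b) ↦ (a, ψ(a) + b)`. -/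
def A₁ : Subgroup (MulAut (SuzukiA Θ)) := (phiLinear Θ).range

/-- The subgroup `A₂` of all automorphisms `(a, b) ↦ (x a, x Θ(x) b)`. -/
def A₂ : Subgroup (MulAut (SuzukiA Θ)) := (phiScalar Θ).range

variable [Finite F]

/-- Automorphisms of a finite field commute with each other. -/
theorem galois_comm (σ τ : F ≃ₐ[ZMod 2] F) (a : F) : σ (τ a) = τ (σ a) := by
  have h : σ * τ = τ * σ := by
    obtain ⟨g, hg⟩ := IsCyclic.exists_generator (α := F ≃ₐ[ZMod 2] F)
    obtain ⟨i, rfl⟩ := hg σ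
    obtain ⟨j, rfl⟩ := hg τ
    exact (Commute.refl g).zpow_zpow i j
  exact DFunLike.congr_fun h a

/-- The homomorphism `τ ↦ φ_τ` where `φ_τ (a, b) = (τ(a), τ(b))`, for `τ` running over the Galois
automorphisms of `F` over `ℤ/2`. -/
def phiGalois : (F ≃ₐ[ZMod 2] F) →* MulAut (SuzukiA Θ) where
  toFun τ :=
    { toFun := fun p => ⟨τ p.fst, τ p.snd⟩
      invFun := fun p => ⟨τ.symm p.fst, τ.symm p.snd⟩
      left_inv := fun p => by ext <;> simp
      right_inv := fun p => by ext <;> simp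
      map_mul' := fun p q => by
        ext
        · simp
        · simp [galois_comm Θ τ] }
  map_one' := by ext p <;> simp
  map_mul' σ τ := by ext p <;> simp
/-- The subgroup `A₃` of all automorphisms `(a, b) ↦ (τ(a), τ(b))`. -/
def A₃ : Subgroup (MulAut (SuzukiA Θ)) := (phiGalois Θ).range

theorem phiGalois_apply (τ : F ≃ₐ[ZMod 2] F) (a b : F) :
    phiGalois Θ τ ⟨a, b⟩ = ⟨τ a, τ b⟩ := rfl

end

end SuzukiA

/-!
An automorphism `φ` of `A(n, Θ)` preserves the elements `(0, c)`, which are those of square `1`,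
so `φ (a, c) = (α a, γ a + β c)` with `α`, `β` additive. Squaring `(a, 0)` gives
`β (a Θ(a)) = α(a) Θ(α(a))`.

The Galois automorphisms form an `F`-basis of the additive maps `F → F`
(`exists_eq_sum_galois`). Write `α = ∑ A_σ σ` and `β = ∑ B_σ σ` and compare the coefficients of
the forms `σ(a) τ(a)` on both sides; this is legitimate by Dedekind's independence of characters,
used in the form `coeff_of_quadratic_eq_zero`. The diagonal coefficients give
`A_σ Θ(A_{Θ⁻¹σ}) = 0`, and the coefficients with `τ ≠ Θ^{±1}σ` give
`A_σ Θ(A_{Θ⁻¹τ}) + A_τ Θ(A_{Θ⁻¹σ}) = 0`. Hence if `A_σ` and `A_ρ` are nonzero with `σ ≠ ρ`, then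
`σ = Θ²ρ` (take `τ = Θρ`) and, by symmetry, `ρ = Θ²σ`, so that `Θ⁴ = 1`. This is
impossible for `Θ ≠ 1` of odd order, so `α = x σ` for a single `σ` (`eq_smul_galois_of_norm_form`).

As `Θ` has odd order, `a ↦ a Θ(a)` is onto (`surjective_mul_map_self`), which forces
`β = x Θ(x) σ`. Then `γ` is additive, and `φ` is the product of its three components.
-/

namespace SuzukiA

section

variable {F : Type*} [Field F] [Algebra (ZMod 2) F]

/-! ### Galois automorphisms as additive maps -/

theorem charP_two (F : Type*) [Field F] [Algebra (ZMod 2) F] : CharP F 2 :=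
  charP_of_injective_algebraMap (algebraMap (ZMod 2) F).injective 2

theorem linearIndependent_galois :
    LinearIndependent F (fun σ : F ≃ₐ[ZMod 2] F => (σ.toLinearMap : F →ₗ[ZMod 2] F)) :=
  (linearIndependent_toLinearMap (ZMod 2) F F).comp
    (fun σ : F ≃ₐ[ZMod 2] F => (σ : F →ₐ[ZMod 2] F))
    (fun _ _ h => AlgEquiv.ext fun a => DFunLike.congr_fun h a)

theorem coeff_of_sum_galois_eq_zero [Fintype (F ≃ₐ[ZMod 2] F)] {c : (F ≃ₐ[ZMod 2] F) → F}
    (h : ∀ a, ∑ σ, c σ * σ a = 0) (σ : F ≃ₐ[ZMod 2] F) : c σ = 0 := by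
  refine Fintype.linearIndependent_iff.1 (linearIndependent_galois (F := F)) c ?_ σ
  ext a
  simpa [LinearMap.sum_apply] using h a

variable [Finite F]

/-- Linearized polynomials: the Galois automorphisms span the additive maps `F → F`, since they
are independent and their number is the dimension. -/
theorem exists_eq_sum_galois [Fintype (F ≃ₐ[ZMod 2] F)] (f : F →ₗ[ZMod 2] F) :
    ∃ A : (F ≃ₐ[ZMod 2] F) → F, ∀ a, f a = ∑ σ, A σ * σ a := by
  have hcard : Fintype.card (F ≃ₐ[ZMod 2] F) = Module.finrank F (F →ₗ[ZMod 2] F) := by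
    rw [Module.finrank_linearMap_self, ← IsGalois.card_aut_eq_finrank, Nat.card_eq_fintype_card]
  have htop := linearIndependent_galois (F := F).span_eq_top_of_card_eq_finrank' hcard
  have hf : f ∈ Submodule.span F
      (Set.range fun σ : F ≃ₐ[ZMod 2] F => (σ.toLinearMap : F →ₗ[ZMod 2] F)) := by
    rw [htop]; trivial
  obtain ⟨A, hA⟩ := (Submodule.mem_span_range_iff_exists_fun F).1 hf
  refine ⟨A, fun a => ?_⟩
  rw [← hA]
  simp [LinearMap.sum_apply]

/-! ### Quadratic forms in the Galois automorphisms -/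

/-- A quadratic form `∑ D_{στ} σ(a) τ(a)` that vanishes identically is alternating in its
coefficients. The off-diagonal part comes from polarization and two applications of the
independence of characters; what then remains is `∑ D_{σσ} σ(a ^ 2)`, and every element of a finite
field of characteristic `2` is a square. -/
theorem coeff_of_quadratic_eq_zero [Fintype (F ≃ₐ[ZMod 2] F)]
    {D : (F ≃ₐ[ZMod 2] F) → (F ≃ₐ[ZMod 2] F) → F}
    (h : ∀ a, ∑ σ, ∑ τ, D σ τ * (σ a * τ a) = 0) :
    (∀ σ τ, D σ τ + D τ σ = 0) ∧ ∀ σ, D σ σ = 0 := by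
  classical
  have := charP_two F
  have hsymm : ∀ σ τ, D σ τ + D τ σ = 0 := by
    intro σ τ
    refine coeff_of_sum_galois_eq_zero (c := fun τ => D σ τ + D τ σ) (fun b => ?_) τ
    refine coeff_of_sum_galois_eq_zero (c := fun σ => ∑ τ, (D σ τ + D τ σ) * τ b) (fun a => ?_) σ
    have hpol : (∑ σ, ∑ τ, D σ τ * (σ a * τ b)) + ∑ σ, ∑ τ, D σ τ * (σ b * τ a) = 0 := by
      have hab := h (a + b)
      have hexp : ∑ σ, ∑ τ, D σ τ * (σ (a + b) * τ (a + b)) =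
          (∑ σ, ∑ τ, D σ τ * (σ a * τ a)) + (∑ σ, ∑ τ, D σ τ * (σ b * τ b)) +
          ((∑ σ, ∑ τ, D σ τ * (σ a * τ b)) + ∑ σ, ∑ τ, D σ τ * (σ b * τ a)) := by
        simp only [← Finset.sum_add_distrib]
        refine Finset.sum_congr rfl fun σ _ => Finset.sum_congr rfl fun τ _ => ?_
        rw [map_add, map_add]; ring
      rw [hexp, h a, h b, zero_add, zero_add] at hab
      exact hab
    rw [Finset.sum_comm (f := fun σ τ => D σ τ * (σ b * τ a))] at hpol
    rw [← hpol]
    simp only [← Finset.sum_add_distrib, Finset.sum_mul]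
    refine Finset.sum_congr rfl fun σ _ => Finset.sum_congr rfl fun τ _ => ?_
    ring
  refine ⟨hsymm, coeff_of_sum_galois_eq_zero fun b => ?_⟩
  obtain ⟨a, rfl⟩ : IsSquare b := FiniteField.isSquare_of_char_two (CharP.ringChar_of_prime_eq_zero
    Nat.prime_two (CharTwo.two_eq_zero (R := F))) b
  -- The off-diagonal terms cancel in pairs under `(σ, τ) ↦ (τ, σ)`.
  have hoff : ∑ p : (F ≃ₐ[ZMod 2] F) × (F ≃ₐ[ZMod 2] F),
      (if p.1 = p.2 then 0 else D p.1 p.2 * (p.1 a * p.2 a)) = 0 := by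
    refine Finset.sum_involution (fun p _ => p.swap) ?_ ?_ (fun _ _ => Finset.mem_univ _)
      (fun p _ => p.swap_swap)
    · rintro ⟨σ, τ⟩ -
      by_cases hστ : σ = τ
      · simp [hστ]
      · simp only [Prod.fst_swap, Prod.snd_swap, if_neg hστ, if_neg (Ne.symm hστ)]
        linear_combination (σ a * τ a) * hsymm σ τ
    · rintro ⟨σ, τ⟩ - hne heq
      exact hne (if_pos (congrArg Prod.snd heq))
  rw [Fintype.sum_prod_type] at hoff
  rw [← h a, ← sub_eq_zero, ← neg_eq_zero, neg_sub, ← Finset.sum_sub_distrib, ← hoff]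
  refine Finset.sum_congr rfl fun σ _ => ?_
  rw [sub_eq_iff_eq_add, ← Finset.sum_erase_add _ _ (Finset.mem_univ σ),
    ← Finset.sum_erase_add _ _ (Finset.mem_univ σ), if_pos rfl, add_zero, map_mul]
  congr 1
  refine Finset.sum_congr rfl fun τ hτ => ?_
  rw [if_neg (Finset.ne_of_mem_erase hτ).symm]

/-- An additive map `α` for which `α(a) Θ(α(a))` is an additive function of `a Θ(a)` is a scalar
multiple of a Galois automorphism. -/
theorem eq_smul_galois_of_norm_form {Θ : F ≃ₐ[ZMod 2] F} (hΘ : Θ ≠ 1) (hodd : Odd (orderOf Θ))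
    (α β : F →ₗ[ZMod 2] F) (h : ∀ a, β (a * Θ a) = α a * Θ (α a)) :
    ∃ (x : F) (σ : F ≃ₐ[ZMod 2] F), ∀ a, α a = x * σ a := by
  classical
  have := Fintype.ofFinite (F ≃ₐ[ZMod 2] F)
  obtain ⟨A, hA⟩ := exists_eq_sum_galois α
  obtain ⟨B, hB⟩ := exists_eq_sum_galois β
  set D : (F ≃ₐ[ZMod 2] F) → (F ≃ₐ[ZMod 2] F) → F := fun σ τ =>
    A σ * Θ (A (Θ⁻¹ * τ)) - if τ = Θ * σ then B σ else 0 with hD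
  have hΘα : ∀ a, Θ (α a) = ∑ τ, Θ (A (Θ⁻¹ * τ)) * τ a := by
    intro a
    rw [hA, map_sum]
    refine Fintype.sum_equiv (Equiv.mulLeft Θ) _ _ fun ρ => ?_
    simp
  obtain ⟨hsymm, hdiag⟩ := coeff_of_quadratic_eq_zero (D := D) (by
    intro a
    have h1 : α a * Θ (α a) = ∑ σ, ∑ τ, A σ * Θ (A (Θ⁻¹ * τ)) * (σ a * τ a) := by
      rw [hΘα, hA, Finset.sum_mul_sum]
      refine Finset.sum_congr rfl fun σ _ => Finset.sum_congr rfl fun τ _ => ?_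
      ring
    have h2 : β (a * Θ a) = ∑ σ, ∑ τ, (if τ = Θ * σ then B σ else 0) * (σ a * τ a) := by
      rw [hB]
      refine Finset.sum_congr rfl fun σ _ => ?_
      simp only [ite_mul, zero_mul, Finset.sum_ite_eq', Finset.mem_univ, if_true, map_mul,
        AlgEquiv.mul_apply, galois_comm σ Θ]
    simp only [hD, sub_mul, Finset.sum_sub_distrib]
    rw [← h1, ← h2, h, sub_self])
  have hdiag' : ∀ ρ, A ρ ≠ 0 → A (Θ * ρ) = 0 := by
    intro ρ hρ
    have := hdiag (Θ * ρ)
    have hne : Θ * ρ ≠ Θ * (Θ * ρ) := fun e => hΘ (by simpa using e)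
    simpa [hD, hne, hρ] using this
  have hpair : ∀ σ ρ, A σ ≠ 0 → A ρ ≠ 0 → σ ≠ ρ → σ = Θ * (Θ * ρ) := by
    intro σ ρ hσ hρ hne
    by_contra hcon
    have := hsymm σ (Θ * ρ)
    simp [hD, hcon, hdiag' ρ hρ, Ne.symm hne, hσ, hρ] at this
  have huniq : ∀ σ ρ, A σ ≠ 0 → A ρ ≠ 0 → σ = ρ := by
    intro σ ρ hσ hρ
    by_contra hne
    have h1 := hpair σ ρ hσ hρ hne
    have h2 := hpair ρ σ hρ hσ (Ne.symm hne)
    have h4 : Θ ^ 4 = 1 := by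
      rw [h2, ← mul_assoc, ← mul_assoc, ← mul_assoc] at h1
      simpa [pow_succ] using h1.symm
    have hcop : Nat.Coprime (orderOf Θ) (2 ^ 2) := hodd.coprime_two_right.pow_right 2
    exact hΘ (orderOf_eq_one_iff.1 (hcop.eq_one_of_dvd (orderOf_dvd_of_pow_eq_one h4)))
  by_cases hex : ∃ σ, A σ ≠ 0
  · obtain ⟨σ, hσ⟩ := hex
    refine ⟨A σ, σ, fun a => ?_⟩
    rw [hA]
    refine Fintype.sum_eq_single σ fun ρ hρσ => ?_
    by_cases hρ : A ρ = 0
    · rw [hρ, zero_mul]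
    · exact absurd (huniq ρ σ hρ hσ) hρσ
  · push Not at hex
    exact ⟨0, 1, fun a => by simp [hA, hex]⟩

/-- If `c Θ(c) = 1` then `Θ²` fixes `c`, hence so does `Θ`, which is a power of `Θ²`; then
`c ^ 2 = 1` and `c = 1`. So `a ↦ a Θ(a)` is injective. -/
theorem surjective_mul_map_self {Θ : F ≃ₐ[ZMod 2] F} (hodd : Odd (orderOf Θ)) :
    Function.Surjective fun a : F => a * Θ a := by
  have := charP_two F
  rw [← Finite.injective_iff_surjective]
  have key : ∀ c : F, c * Θ c = 1 → c = 1 := by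
    intro c hc
    have hc1 : Θ c = c⁻¹ := eq_inv_of_mul_eq_one_right hc
    have hsq : Θ ^ 2 ∈ MulAction.stabilizer (F ≃ₐ[ZMod 2] F) c := by
      rw [MulAction.mem_stabilizer_iff, AlgEquiv.smul_def, pow_two, AlgEquiv.mul_apply, hc1,
        map_inv₀, hc1, inv_inv]
    obtain ⟨k, hk⟩ := hodd
    have hfix : Θ ∈ MulAction.stabilizer (F ≃ₐ[ZMod 2] F) c := by
      have hpow : (Θ ^ 2) ^ (k + 1) = Θ := by
        rw [← pow_mul, show 2 * (k + 1) = (2 * k + 1) + 1 by ring, ← hk, pow_succ,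
          pow_orderOf_eq_one, one_mul]
      rw [← hpow]
      exact pow_mem hsq _
    have hfix' : Θ c = c := hfix
    rw [hfix', ← pow_two] at hc
    exact CharTwo.sq_injective (by simpa using hc)
  intro a b hab
  simp only at hab
  by_cases hb : b = 0
  · subst hb
    simpa using hab
  · have hΘb : Θ b ≠ 0 := by simpa using hb
    have := key (a / b) (by rw [map_div₀]; field_simp; exact hab)
    exact (div_eq_one_iff_eq hb).1 this

end

/-! ### Automorphisms of `A(n, Θ)` -/

section

variable {F : Type*} [Field F] [Algebra (ZMod 2) F] {Θ : F ≃ₐ[ZMod 2] F}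

theorem mul_self_eq_one_iff (p : SuzukiA Θ) : p * p = 1 ↔ p.fst = 0 := by
  have := charP_two F
  rw [SuzukiA.ext_iff]
  simp [CharTwo.add_self_eq_zero]

theorem mulAut_fst_eq_zero_iff (φ : MulAut (SuzukiA Θ)) (p : SuzukiA Θ) :
    (φ p).fst = 0 ↔ p.fst = 0 := by
  rw [← mul_self_eq_one_iff, ← mul_self_eq_one_iff, ← map_mul, map_eq_one_iff φ φ.injective]

/-- The additive map that an automorphism induces on the quotient by `{(0, c)}`. -/
def quotientMap (φ : MulAut (SuzukiA Θ)) : F →ₗ[ZMod 2] F :=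
  AddMonoidHom.toZModLinearMap 2
    (AddMonoidHom.mk' (fun a => (φ ⟨a, 0⟩).fst) fun a b => by
      have h : (⟨a + b, 0⟩ : SuzukiA Θ) = ⟨a, 0⟩ * ⟨b, 0⟩ * ⟨0, -(b * Θ a)⟩ := by
        ext <;> simp
      have h0 : (φ ⟨0, -(b * Θ a)⟩).fst = 0 := (mulAut_fst_eq_zero_iff φ _).2 rfl
      rw [h, map_mul, map_mul, mul_fst, mul_fst, h0, add_zero])

/-- The additive map that an automorphism induces on `{(0, c)}`. -/
def centralMap (φ : MulAut (SuzukiA Θ)) : F →ₗ[ZMod 2] F :=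
  AddMonoidHom.toZModLinearMap 2
    (AddMonoidHom.mk' (fun c => (φ ⟨0, c⟩).snd) fun c d => by
      have h : (⟨0, c + d⟩ : SuzukiA Θ) = ⟨0, c⟩ * ⟨0, d⟩ := by
        ext <;> simp
      have h0 : (φ ⟨0, c⟩).fst = 0 := (mulAut_fst_eq_zero_iff φ _).2 rfl
      rw [h, map_mul, mul_snd, h0, map_zero, mul_zero, add_zero])

theorem mulAut_apply (φ : MulAut (SuzukiA Θ)) (a c : F) :
    φ ⟨a, c⟩ = ⟨quotientMap φ a, (φ ⟨a, 0⟩).snd + centralMap φ c⟩ := by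
  have h : (⟨a, c⟩ : SuzukiA Θ) = ⟨0, c⟩ * ⟨a, 0⟩ := by
    ext <;> simp
  have h0 : (φ ⟨0, c⟩).fst = 0 := (mulAut_fst_eq_zero_iff φ _).2 rfl
  rw [h, map_mul]
  ext
  · rw [mul_fst, h0, zero_add]; rfl
  · rw [mul_snd, h0, map_zero, mul_zero, add_zero, add_comm]; rfl

theorem snd_add_centralMap (φ : MulAut (SuzukiA Θ)) (a b : F) :
    (φ ⟨a + b, 0⟩).snd + centralMap φ (b * Θ a) =
      (φ ⟨a, 0⟩).snd + (φ ⟨b, 0⟩).snd + quotientMap φ b * Θ (quotientMap φ a) := by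
  have h : (⟨a + b, b * Θ a⟩ : SuzukiA Θ) = ⟨a, 0⟩ * ⟨b, 0⟩ := by
    ext <;> simp
  have h' := congrArg (fun p => (φ p).snd) h
  simp only [map_mul, mul_snd] at h'
  rw [mulAut_apply φ (a + b)] at h'
  exact h'

theorem centralMap_mul_map_self (φ : MulAut (SuzukiA Θ)) (a : F) :
    centralMap φ (a * Θ a) = quotientMap φ a * Θ (quotientMap φ a) := by
  have := charP_two F
  have h := snd_add_centralMap φ a a
  have h1 : φ (⟨0, 0⟩ : SuzukiA Θ) = 1 := map_one φ
  rwa [CharTwo.add_self_eq_zero, h1, one_snd, zero_add, CharTwo.add_self_eq_zero, zero_add] at h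

theorem exists_eq_phi_mul [Finite F] (hΘ : Θ ≠ 1) (hodd : Odd (orderOf Θ)) (φ : MulAut (SuzukiA Θ)) :
    ∃ (ψ : F →ₗ[ZMod 2] F) (x : Fˣ) (σ : F ≃ₐ[ZMod 2] F),
      phiLinear Θ (Multiplicative.ofAdd ψ) * phiScalar Θ x * phiGalois Θ σ = φ := by
  obtain ⟨x, σ, hα⟩ := eq_smul_galois_of_norm_form hΘ hodd (quotientMap φ) (centralMap φ)
    (centralMap_mul_map_self φ)
  have hx : x ≠ 0 := by
    rintro rfl
    have h1 : (φ ⟨1, 0⟩).fst = 0 := (hα 1).trans (zero_mul _)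
    exact one_ne_zero ((mulAut_fst_eq_zero_iff φ _).1 h1)
  have hβ : ∀ c, centralMap φ c = x * Θ x * σ c := by
    intro c
    obtain ⟨a, rfl⟩ := surjective_mul_map_self hodd c
    simp only [centralMap_mul_map_self, hα, map_mul, galois_comm σ Θ]
    ring
  have hγ : ∀ a b, (φ ⟨a + b, 0⟩).snd = (φ ⟨a, 0⟩).snd + (φ ⟨b, 0⟩).snd := by
    intro a b
    have h := snd_add_centralMap φ a b
    simp only [hα, hβ, map_mul, galois_comm σ Θ] at h
    linear_combination h
  let γ : F →ₗ[ZMod 2] F := AddMonoidHom.toZModLinearMap 2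
    (AddMonoidHom.mk' (fun a => (φ ⟨a, 0⟩).snd) hγ)
  -- The second coordinate requires `ψ (x σ(a)) = γ a`.
  let ψ : F →ₗ[ZMod 2] F := γ ∘ₗ σ.symm.toLinearMap ∘ₗ LinearMap.mulLeft (ZMod 2) x⁻¹
  have hψ : ∀ a, ψ (x * σ a) = (φ ⟨a, 0⟩).snd := by
    intro a
    have h : σ.symm (x⁻¹ * (x * σ a)) = a := by
      rw [inv_mul_cancel_left₀ hx, AlgEquiv.symm_apply_apply]
    exact congrArg γ h
  refine ⟨ψ, Units.mk0 x hx, σ, ?_⟩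
  refine MulEquiv.ext fun ⟨a, c⟩ => ?_
  rw [MulAut.mul_apply, MulAut.mul_apply, phiGalois_apply, phiScalar_apply, phiLinear_apply,
    mulAut_apply φ a c, Units.val_mk0, hψ, hα, hβ]

end

end SuzukiA

theorem mainTheorem8 {F : Type*} [Field F] [Finite F] [Algebra (ZMod 2) F]
    (n : ℕ) (hF : Nat.card F = 2 ^ n)
    (Θ : F ≃ₐ[ZMod 2] F) (hΘ : Θ ≠ 1) (hodd : Odd (orderOf Θ)) :
    (SuzukiA.A₁ Θ : Set (MulAut (SuzukiA Θ))) * (SuzukiA.A₂ Θ : Set (MulAut (SuzukiA Θ))) *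
      (SuzukiA.A₃ Θ : Set (MulAut (SuzukiA Θ))) = Set.univ := by
  refine Set.eq_univ_of_forall fun φ => ?_
  obtain ⟨ψ, x, σ, h⟩ := SuzukiA.exists_eq_phi_mul hΘ hodd φ
  rw [← h]
  exact Set.mul_mem_mul (Set.mul_mem_mul ⟨_, rfl⟩ ⟨_, rfl⟩) ⟨_, rfl⟩
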